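/- Let $\mathcal T$ be a triangulated category with arbitrary coproducts and suspension $\Sigma$, and let $S\in\mathcal T$ be a compact object which generates $\mathcal T$ (the smallest thick subcategory of $\mathcal T$ that contains $S$ and is closed under arbitrary coproducts is $\mathcal T$ itself). Write $\pi_n X=[S,X]_n=\operatorname{Hom}_{\mathcal T}(\Sigma^n S,X)$ for $n\in\mathbb Z$, so that $\pi_*S$ is a graded ring and $\pi_*X$ is a graded right $\pi_*S$-module, and assume that $\pi_*S$ is graded commutative. For a triangulated category $\mathcal C$ with distinguished object $U$, the *global generating hypothesis* says that the functor $[U,-]_*$ from $\mathcal C$ to graded right $[U,U]_*$-modules is faithful. The *strong generating hypothesis* says that every map $f:X\to Y$ in $\mathcal C$, with $X$ in the thick subcategory generated by $U$ and $Y$ arbitrary, such that $[U,f]_*=0$, is zero. A *localization functor* on $\mathcal T$ is an exact functor $L:\mathcal T\to\mathcal T$ with a natural transformation $\iota:1\to L$ such that $L\iota$ is an isomorphism and $\iota_Y^*:[LY,LX]_*\to[Y,LX]_*$ is bijective for all $X,Y$. Let $\mathfrak p$ be a homogeneous prime ideal of $\pi_*S$, and for a graded right $\pi_*S$-module $M$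 let $M_{\mathfrak p}$ be the graded module obtained from $M$ by inverting the homogeneous elements of $\pi_*S$ outside $\mathfrak p$. Then there exists a localization functor $(L_{\mathfrak p},\iota)$ on $\mathcal T$ such that, for every $X\in\mathcal T$, the map $\pi_*(\iota_X):\pi_*X\to\pi_*L_{\mathfrak p}X$ exhibits $\pi_*L_{\mathfrak p}X$ as $(\pi_*X)_{\mathfrak p}$. Moreover, for any such functor $L_{\mathfrak p}$, let $\mathcal T_{\mathfrak p}$ be the triangulated full subcategory of $\mathfrak p$-local objects (the objects in the essential image of $L_{\mathfrak p}$), with distinguished object $L_{\mathfrak p}S$. If $\mathcal T$ (with distinguished object $S$) satisfies the strong generating hypothesis, then so does $\mathcal T_{\mathfrak p}$; and if $\mathcal T$ satisfies the global generating hypothesis, then so does $\mathcal T_{\mathfrak p}$. -/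

import Mathlib

open CategoryTheory Category Limits Pretriangulated ZeroObject

universe v u

namespace GeneratingHypothesis

/-! ### Homotopy groups `π_n X = [S, X]_n = Hom(Σⁿ S, X)` -/

section Homotopy

variable {T : Type u} [Category.{v} T] [HasShift T ℤ]

/-- The degree `n` part `π_n X = Hom(Σⁿ S, X)` of `π_* X = [S, X]_*`. -/
abbrev HomotopyGroup (S X : T) (n : ℤ) : Type v := S⟦n⟧ ⟶ X

/-- The right action of `π_* S` on `π_* X`: for `x ∈ π_m X` and `a ∈ π_n S` the element
`x · a ∈ π_{n+m} X` is the composite `Σ^{n+m} S ≅ Σ^m Σ^n S ⟶ Σ^m S ⟶ X` of `Σ^m a` and `x`.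
For `X = S` this is the multiplication of the graded ring `π_* S`. The target degree `k` is
any integer with a proof that it equals `n + m`. -/
def act {S X : T} {m n : ℤ} (x : HomotopyGroup S X m) (a : HomotopyGroup S S n)
    (k : ℤ) (h : n + m = k) : HomotopyGroup S X k :=
  (shiftFunctorAdd' T n m k h).hom.app S ≫ a⟦m⟧' ≫ x

/-- The unit of the graded ring `π_* S`, of degree `0`. -/
def unit (S : T) : HomotopyGroup S S 0 := (shiftFunctorZero T ℤ).hom.app S

variable [Preadditive T]

/-- The functor `π_* = [S, -]_*`, recorded through the underlying graded abelian groups. (A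
morphism of graded right `π_* S`-modules is determined by its underlying map of graded abelian
groups, so faithfulness of `π_*`, or vanishing of `π_* f`, is the same for both targets.) -/
def homotopyFunctor (S : T) : T ⥤ GradedObject ℤ AddCommGrpCat.{v} where
  obj X := fun n => AddCommGrpCat.of (HomotopyGroup S X n)
  map f := fun n => AddCommGrpCat.ofHom
    { toFun := fun x => x ≫ f
      map_zero' := zero_comp
      map_add' := fun x y => Preadditive.add_comp _ _ _ x y f }
  map_id X := by
    funext n
    ext x
    exact comp_id (x : S⟦n⟧ ⟶ X)
  map_comp f g := by
    funext n
    ext x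
    exact (assoc x f g).symm

/-- `π_* S` is graded commutative: `a b = (-1)^{|a||b|} b a` for homogeneous `a`, `b`. -/
def IsGradedCommutative (S : T) : Prop :=
  ∀ (m n : ℤ) (a : HomotopyGroup S S m) (b : HomotopyGroup S S n),
    act a b (m + n) (add_comm n m) = (m * n).negOnePow • act b a (m + n) rfl

/-- A (homogeneous) prime ideal of the graded ring `π_* S`, given by its homogeneous parts: a
proper two-sided homogeneous ideal such that a product of homogeneous elements lies in it only
if one of the factors does. -/
structure PrimeIdeal (S : T) where
  /-- The degree `n` part of the ideal. -/
  part : ∀ n : ℤ, AddSubgroup (HomotopyGroup S S n)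
  mul_mem_right : ∀ {m n : ℤ} (a : HomotopyGroup S S m) (b : HomotopyGroup S S n) (k : ℤ)
    (h : n + m = k), a ∈ part m → act a b k h ∈ part k
  mul_mem_left : ∀ {m n : ℤ} (a : HomotopyGroup S S m) (b : HomotopyGroup S S n) (k : ℤ)
    (h : n + m = k), b ∈ part n → act a b k h ∈ part k
  unit_notMem : unit S ∉ part 0
  mem_or_mem : ∀ {m n : ℤ} (a : HomotopyGroup S S m) (b : HomotopyGroup S S n) (k : ℤ)
    (h : n + m = k), act a b k h ∈ part k → a ∈ part m ∨ b ∈ part n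

/-- A map `f : X ⟶ Y` exhibits `π_* Y` as the localization `(π_* X)_𝔭` of the graded right
`π_* S`-module `π_* X`, obtained by inverting the homogeneous elements outside `𝔭`: such elements
act bijectively on `π_* Y`, every homogeneous element of `π_* Y` is a fraction `π_*(f)(x) / s`,
and the kernel of `π_* f` consists of the elements killed by some homogeneous `s ∉ 𝔭`. -/
structure IsLocalizationAt {S : T} (p : PrimeIdeal S) {X Y : T} (f : X ⟶ Y) : Prop where
  bijective : ∀ (m n : ℤ) (s : HomotopyGroup S S n), s ∉ p.part n →
    Function.Bijective (fun y : HomotopyGroup S Y m => act y s (n + m) rfl)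
  surj : ∀ (m : ℤ) (y : HomotopyGroup S Y m), ∃ (n : ℤ) (s : HomotopyGroup S S n)
    (x : HomotopyGroup S X (n + m)), s ∉ p.part n ∧ x ≫ f = act y s (n + m) rfl
  exists_of_eq_zero : ∀ (m : ℤ) (x : HomotopyGroup S X m), x ≫ f = 0 →
    ∃ (n : ℤ) (s : HomotopyGroup S S n), s ∉ p.part n ∧ act x s (n + m) rfl = 0

end Homotopy

/-! ### Compact generators -/

section Compact

variable {T : Type u} [Category.{v} T] [Preadditive T]

open Classical in
/-- `S` is compact: for every family `(X_j)`, the canonical map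
`⨁ Hom(S, X_j) → Hom(S, ∐ X_j)` is bijective. -/
def IsCompactObject [HasCoproducts.{v} T] (S : T) : Prop :=
  ∀ (J : Type v) (X : J → T), Function.Bijective
    (DirectSum.toAddMonoid (β := fun j => (S ⟶ X j)) (γ := (S ⟶ ∐ X))
      (fun j => Preadditive.rightComp S (Sigma.ι X j)))

variable [HasZeroObject T] [HasShift T ℤ] [∀ n : ℤ, (shiftFunctor T n).Additive]
  [Pretriangulated T]

/-- The localizing subcategory generated by `S`: the smallest thick subcategory containing `S`
and closed under arbitrary coproducts. -/
def localizingSubcategory (S : T) : ObjectProperty T := fun X =>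
  ∀ P : ObjectProperty T, P.IsTriangulated → P.IsStableUnderRetracts →
    (∀ J : Type v, P.IsClosedUnderColimitsOfShape (Discrete J)) → P S → P X

/-- `S` generates `T`: the localizing subcategory generated by `S` is all of `T`. -/
def Generates (S : T) : Prop := ∀ X : T, localizingSubcategory S X

end Compact

/-! ### The generating hypotheses -/

section Hypotheses

variable {T : Type u} [Category.{v} T] [Preadditive T] [HasShift T ℤ]

/-- The global generating hypothesis for `(T, S)`: the functor `π_* = [S, -]_*` is faithful. -/
def GlobalGeneratingHypothesis (S : T) : Prop := (homotopyFunctor S).Faithful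

variable [HasZeroObject T] [∀ n : ℤ, (shiftFunctor T n).Additive] [Pretriangulated T]

/-- The thick subcategory generated by `S`: the smallest triangulated subcategory closed under
retracts that contains `S`. -/
abbrev thickSubcategory (S : T) : ObjectProperty T :=
  (ObjectProperty.singleton S).triangEnvelope

/-- The strong generating hypothesis for `(T, S)`: a map `f : X ⟶ Y` with `X` in the thick
subcategory generated by `S` and with `π_* f = 0` is zero. -/
def StrongGeneratingHypothesis (S : T) : Prop :=
  ∀ (X Y : T) (f : X ⟶ Y), thickSubcategory S X → (homotopyFunctor S).map f = 0 → f = 0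

end Hypotheses

/-! ### Localization functors and local objects -/

section Localization

variable (T : Type u) [Category.{v} T] [Preadditive T] [HasZeroObject T] [HasShift T ℤ]
  [∀ n : ℤ, (shiftFunctor T n).Additive] [Pretriangulated T]

/-- A localization functor on a triangulated category: an exact functor `L` with a natural
transformation `ι : 1 ⟶ L` such that `L ι` is an isomorphism and
`ι_Y^* : [L Y, L X]_* → [Y, L X]_*` is bijective for all `X`, `Y`. -/
structure LocalizationFunctor where
  /-- The underlying functor `L`. -/
  functor : T ⥤ T
  /-- The compatibility of `L` with suspension. -/
  [commShift : functor.CommShift ℤ]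
  [isTriangulated : functor.IsTriangulated]
  /-- The natural map `X ⟶ L X`. -/
  ι : 𝟭 T ⟶ functor
  isIso_map_ι : ∀ X : T, IsIso (functor.map (ι.app X))
  bijective_precomp : ∀ (X Y : T) (n : ℤ), Function.Bijective
    (fun g : (functor.obj Y)⟦n⟧ ⟶ functor.obj X => (ι.app Y)⟦n⟧' ≫ g)

attribute [instance] LocalizationFunctor.commShift LocalizationFunctor.isTriangulated

variable {T}

namespace LocalizationFunctor

variable (L : LocalizationFunctor T)

/-- `L` is a `𝔭`-localization functor: `π_* L X` is the localization `(π_* X)_𝔭`, via `ι_X`. -/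
def IsLocalizationAtPrime {S : T} (p : PrimeIdeal S) : Prop :=
  ∀ X : T, IsLocalizationAt p (L.ι.app X)

/-- The local objects: those in the (essential) image of `L`. -/
abbrev localObjects : ObjectProperty T := L.functor.essImage

lemma comp_injective {X Y : T} {g h : L.functor.obj Y ⟶ L.functor.obj X}
    (e : L.ι.app Y ≫ g = L.ι.app Y ≫ h) : g = h := by
  let i := (shiftFunctorZero T ℤ).hom.app (L.functor.obj Y)
  have key := (L.bijective_precomp X Y 0).1 (a₁ := i ≫ g) (a₂ := i ≫ h) (by
    have nat := (shiftFunctorZero T ℤ).hom.naturality (L.ι.app Y)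
    dsimp at nat
    simp only [i, ← assoc]
    erw [nat]
    simp only [assoc]
    erw [e])
  exact (cancel_epi i).1 key

lemma map_ι_eq (X : T) : L.functor.map (L.ι.app X) = L.ι.app (L.functor.obj X) := by
  have := L.isIso_map_ι X
  apply L.comp_injective
  exact (L.ι.naturality (L.ι.app X)).symm

lemma isIso_ι (X : T) : IsIso (L.ι.app (L.functor.obj X)) := by
  rw [← L.map_ι_eq]
  exact L.isIso_map_ι X

lemma mem_localObjects_iff (X : T) : L.localObjects X ↔ IsIso (L.ι.app X) := by
  constructor
  · rintro ⟨Y, ⟨e⟩⟩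
    have h := L.ι.naturality e.hom
    have := L.isIso_ι Y
    have h2 : L.ι.app X = e.inv ≫ L.ι.app (L.functor.obj Y) ≫ L.functor.map e.hom := by
      rw [← h]
      simp
    rw [h2]
    infer_instance
  · intro h
    exact ⟨X, ⟨(asIso (L.ι.app X)).symm⟩⟩

instance : L.localObjects.IsStableUnderShift ℤ where
  isStableUnderShiftBy n :=
    { le_shift := by
        rintro Y ⟨X, ⟨e⟩⟩
        exact ⟨X⟦n⟧, ⟨(L.functor.commShiftIso n).app X ≪≫ (shiftFunctor T n).mapIso e⟩⟩ }

instance : L.localObjects.IsTriangulatedClosed₃ := .mk' (by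
  intro D hD h₁ h₂
  have i₁ := (L.mem_localObjects_iff _).1 h₁
  have i₂ := (L.mem_localObjects_iff _).1 h₂
  exact ⟨D.obj₃, ⟨Triangle.π₃.mapIso (isoTriangleOfIso₁₂ D (L.functor.mapTriangle.obj D) hD
    (L.functor.map_distinguished D hD) (@asIso _ _ _ _ (L.ι.app D.obj₁) i₁)
    (@asIso _ _ _ _ (L.ι.app D.obj₂) i₂)
    (L.ι.naturality D.mor₁)).symm⟩⟩)

/-- The local objects form a triangulated subcategory. -/
instance : L.localObjects.IsTriangulated where
  exists_zero := ⟨L.functor.obj 0, L.functor.map_isZero (isZero_zero T),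
    L.functor.obj_mem_essImage _⟩
  toIsTriangulatedClosed₂ := .of_isTriangulatedClosed₃

/-- The triangulated category `T_𝔭` of local objects, as a full subcategory of `T`. -/
abbrev LocalCategory : Type u := L.localObjects.FullSubcategory

/-- The distinguished object `L S` of the category of local objects. -/
abbrev localUnit (S : T) : L.LocalCategory := ⟨L.functor.obj S, L.functor.obj_mem_essImage S⟩

end LocalizationFunctor

end Localization

end GeneratingHypothesis

/-! For each homogeneous `s ∉ 𝔭` form the cone of `s : Σⁿ S ⟶ S`. By the long exact sequence, an
object receives only zero maps from the shifts of these cones exactly when every such `s` acts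
bijectively on its homotopy (`cellLocal_primeCone_iff`). The cones are compact, so killing all maps
from them repeatedly and passing to the telescope reflects `T` onto these objects. Graded
commutativity makes the homotopy of each cone torsion (`torsionObjects_cone`), so attaching cells
changes homotopy only by torsion kernels and cokernels, and the telescope realizes `(π_* X)_𝔭`
(`IsCellTower.isLocalizationAt`).

Any `𝔭`-localization `L` has these same local objects, because `S` generates and so `π_*` detects
isomorphisms (`localObjects_of_cellLocal`). Maps from `Σⁿ S` to a local object extend over `Σⁿ L S`,
so a map of local objects invisible to `L S` is invisible to `S`; the global hypothesis passes to
the full subcategory at once.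

The strong hypothesis also needs control of the thick subcategory of `L S`: its objects are retracts
of `L c` with `c` in the thick subcategory of `S` (`thickSubcategory_localUnit_le`). The key is
`exists_lift`: a map `c ⟶ L Y` lifts to `Y` after precomposition with some `c' ⟶ c` that `L`
inverts. Hence maps between such `L c` come from `T` up to isomorphism, and the retracts are closed
under cones. A map out of a retract of `L c` is then tested on `c`. -/

namespace GeneratingHypothesis

/-! ### Exactness of Hom in a distinguished triangle -/

section DistinguishedTriangles

variable {T : Type u} [Category.{v} T] [Preadditive T] [HasZeroObject T] [HasShift T ℤ]
  [∀ n : ℤ, (shiftFunctor T n).Additive] [Pretriangulated T]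
  {A B C : T} {f : A ⟶ B} {g : B ⟶ C} {h : C ⟶ A⟦(1 : ℤ)⟧} (H : Triangle.mk f g h ∈ distTriang T)

include H

lemma distTriang_comp₁₂ : f ≫ g = 0 := comp_distTriang_mor_zero₁₂ _ H

lemma distTriang_comp₃₁ : h ≫ f⟦(1 : ℤ)⟧' = 0 := comp_distTriang_mor_zero₃₁ _ H

lemma distTriang_fac₁ {X : T} (x : X ⟶ B) (hx : x ≫ g = 0) : ∃ y, x = y ≫ f :=
  Triangle.coyoneda_exact₂ _ H x hx

lemma distTriang_fac₂ {X : T} (x : X ⟶ C) (hx : x ≫ h = 0) : ∃ y, x = y ≫ g :=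
  Triangle.coyoneda_exact₃ _ H x hx

lemma distTriang_desc₂ {X : T} (x : B ⟶ X) (hx : f ≫ x = 0) : ∃ y, x = g ≫ y :=
  Triangle.yoneda_exact₂ _ H x hx

lemma distTriang_desc₃ {X : T} (x : C ⟶ X) (hx : g ≫ x = 0) : ∃ y, x = h ≫ y :=
  Triangle.yoneda_exact₃ _ H x hx

end DistinguishedTriangles

/-! ### Compact objects form a thick subcategory -/

section CompactObjects

variable {T : Type u} [Category.{v} T] [Preadditive T] [HasCoproducts.{v} T]

/-- The compact objects, characterized by the fact that every map to a coproduct is a finite sum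
of maps through the inclusions of summands. -/
def compactObjects (T : Type u) [Category.{v} T] [Preadditive T] [HasCoproducts.{v} T] :
    ObjectProperty T := fun c =>
  ∀ (J : Type v) (X : J → T) (f : c ⟶ ∐ X), ∃ (F : Finset J) (g : ∀ j, c ⟶ X j),
    f = ∑ j ∈ F, g j ≫ Sigma.ι X j

lemma IsCompactObject.compactObjects {S : T} (hS : IsCompactObject S) : compactObjects T S := by
  classical
  intro J X f
  obtain ⟨x, rfl⟩ := (hS J X).2 f
  refine ⟨DFinsupp.support x, fun j => x j, ?_⟩
  exact DFinsupp.sumAddHom_apply _ _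

instance : (compactObjects T).IsStableUnderRetracts where
  of_retract := by
    intro c c' r hc' J X f
    obtain ⟨F, g, hg⟩ := hc' J X (r.r ≫ f)
    refine ⟨F, fun j => r.i ≫ g j, ?_⟩
    simp only [assoc, ← Preadditive.comp_sum, ← hg, r.retract_assoc]

/-- Compactness phrased as the vanishing of a composite can be fed into exact sequences, unlike the
mere existence of a finite sum. -/
lemma exists_finset_forall_comp_sigmaπ_eq_zero {c : T} (hc : compactObjects T c) {J : Type v}
    [DecidableEq J] (X : J → T) (f : c ⟶ ∐ X) :
    ∃ F : Finset J, f ≫ (𝟙 _ - ∑ j ∈ F, Sigma.π X j ≫ Sigma.ι X j) = 0 := by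
  obtain ⟨F, g, rfl⟩ := hc J X f
  refine ⟨F, ?_⟩
  rw [Preadditive.comp_sub, comp_id, sub_eq_zero, Preadditive.sum_comp]
  refine Finset.sum_congr rfl fun j hj => ?_
  rw [assoc, Preadditive.comp_sum, Finset.sum_eq_single j]
  · simp
  · intro k _ hk
    rw [Sigma.ι_π_of_ne_assoc _ hk.symm, zero_comp]
  · exact fun h => absurd hj h

lemma finiteSum_add {c : T} {J : Type v} [DecidableEq J] {X : J → T} (F₁ F₂ : Finset J)
    (g₁ g₂ : ∀ j, c ⟶ X j) :
    ∃ (F : Finset J) (g : ∀ j, c ⟶ X j),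
      ∑ j ∈ F₁, g₁ j ≫ Sigma.ι X j + ∑ j ∈ F₂, g₂ j ≫ Sigma.ι X j =
        ∑ j ∈ F, g j ≫ Sigma.ι X j := by
  refine ⟨F₁ ∪ F₂, fun j => (if j ∈ F₁ then g₁ j else 0) + (if j ∈ F₂ then g₂ j else 0), ?_⟩
  simp only [Preadditive.add_comp, Finset.sum_add_distrib, ite_comp, zero_comp]
  congr 1
  · rw [Finset.sum_ite_mem, Finset.inter_eq_right.2 Finset.subset_union_left]
  · rw [Finset.sum_ite_mem, Finset.inter_eq_right.2 Finset.subset_union_right]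

variable [HasZeroObject T] [HasShift T ℤ] [∀ n : ℤ, (shiftFunctor T n).Additive]
  [Pretriangulated T]

instance : (compactObjects T).ContainsZero where
  exists_zero := ⟨0, isZero_zero T, fun _ _ _ => ⟨∅, fun _ => 0, (isZero_zero T).eq_of_src _ _⟩⟩

instance : (compactObjects T).IsStableUnderShift ℤ where
  isStableUnderShiftBy n :=
    { le_shift := by
        intro c hc J X f
        let e : c ≅ c⟦n⟧⟦-n⟧ := (shiftEquiv T n).unitIso.app c
        obtain ⟨F, g, hg⟩ := hc J (fun j => (X j)⟦-n⟧)
          (e.hom ≫ f⟦-n⟧' ≫ inv (sigmaComparison (shiftFunctor T (-n)) X))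
        choose k hk using fun j => (shiftFunctor T (-n)).map_surjective (X := c⟦n⟧) (e.inv ≫ g j)
        refine ⟨F, k, (shiftFunctor T (-n)).map_injective ?_⟩
        rw [← cancel_epi e.hom, ← cancel_mono (inv (sigmaComparison (shiftFunctor T (-n)) X)),
          assoc, hg, Functor.map_sum, Preadditive.comp_sum, Preadditive.sum_comp]
        refine Finset.sum_congr rfl fun j _ => ?_
        rw [Functor.map_comp, hk, assoc, assoc, assoc, e.hom_inv_id_assoc,
          ← ι_comp_sigmaComparison, assoc, IsIso.hom_inv_id, comp_id] }

/-- Subtracting from `f` its components in `F₁` makes it vanish on the first vertex, so the rest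
factors through the third vertex, where finitely many components `F₂` suffice. -/
instance : (compactObjects T).IsTriangulatedClosed₂ := .mk' (by
  classical
  intro D hD h₁ h₃ J X f
  obtain ⟨F₁, hF₁⟩ := exists_finset_forall_comp_sigmaπ_eq_zero h₁ X (D.mor₁ ≫ f)
  obtain ⟨g, hg⟩ := Triangle.yoneda_exact₂ D hD _ ((assoc _ _ _).symm.trans hF₁)
  obtain ⟨F₂, hF₂⟩ := exists_finset_forall_comp_sigmaπ_eq_zero h₃ X g
  obtain ⟨F, g', h⟩ := finiteSum_add F₁ F₂ (fun j => f ≫ Sigma.π X j)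
    (fun j => (D.mor₂ ≫ g) ≫ Sigma.π X j)
  refine ⟨F, g', h ▸ ?_⟩
  rw [Preadditive.comp_sub, comp_id, sub_eq_zero] at hF₂
  rw [Preadditive.comp_sub, comp_id, sub_eq_iff_eq_add'] at hg
  simp only [assoc, ← Preadditive.comp_sum]
  rw [← hF₂, ← hg])

instance : (compactObjects T).IsTriangulated where

lemma thickSubcategory_le_compactObjects {S : T} (hS : IsCompactObject S) :
    thickSubcategory S ≤ compactObjects T := by
  rw [ObjectProperty.triangEnvelope_le_iff, ObjectProperty.singleton_le_iff]
  exact hS.compactObjects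

end CompactObjects

end GeneratingHypothesis

namespace GeneratingHypothesis

/-! ### Homotopy colimits of sequences -/

section Telescope

variable {T : Type u} [Category.{v} T] [HasCoproducts.{v} T] (F : ℕ ⥤ T)

/-- The terms of a sequence of objects, as a family indexed by a type in the universe `v`. -/
abbrev telescopeTerm (k : ULift.{v} ℕ) : T := F.obj k.down

/-- The inclusion of a term of a sequence in the coproduct of all terms. -/
noncomputable abbrev telescopeι (k : ℕ) : F.obj k ⟶ ∐ telescopeTerm F :=
  Sigma.ι (telescopeTerm F) ⟨k⟩

/-- The transition map of a sequence. -/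
abbrev transition (k : ℕ) : F.obj k ⟶ F.obj (k + 1) := F.map (homOfLE (Nat.le_add_right k 1))

variable {F} in
/-- The map from the coproduct of all terms of a sequence that is given by a family of maps. -/
noncomputable def telescopeDesc {H : T} (j : ∀ k, F.obj k ⟶ H) : ∐ telescopeTerm F ⟶ H :=
  Sigma.desc fun k => j k.down

variable {F} in
@[simp]
lemma ι_telescopeDesc {H : T} (j : ∀ k, F.obj k ⟶ H) (k : ℕ) :
    telescopeι F k ≫ telescopeDesc j = j k :=
  Sigma.ι_desc _ _

variable {F} in
@[simp]
lemma ι_telescopeDesc_assoc {H Z : T} (j : ∀ k, F.obj k ⟶ H) (k : ℕ) (f : H ⟶ Z) :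
    telescopeι F k ≫ telescopeDesc j ≫ f = j k ≫ f := by
  rw [← assoc, ι_telescopeDesc]

variable {F} in
lemma telescope_hom_ext {H : T} {f g : ∐ telescopeTerm F ⟶ H}
    (h : ∀ k, telescopeι F k ≫ f = telescopeι F k ≫ g) : f = g :=
  Sigma.hom_ext _ _ fun ⟨k⟩ => h k

variable [Preadditive T]

/-- The map `1 - shift` whose cone is the homotopy colimit of a sequence. -/
noncomputable def oneSubShift : ∐ telescopeTerm F ⟶ ∐ telescopeTerm F :=
  Sigma.desc fun k => telescopeι F k.down - transition F k.down ≫ telescopeι F (k.down + 1)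

lemma ι_oneSubShift (k : ℕ) : telescopeι F k ≫ oneSubShift F =
    telescopeι F k - transition F k ≫ telescopeι F (k + 1) :=
  Sigma.ι_desc _ _

lemma ι_oneSubShift_assoc (k : ℕ) {Z : T} (f : ∐ telescopeTerm F ⟶ Z) :
    telescopeι F k ≫ oneSubShift F ≫ f =
      (telescopeι F k - transition F k ≫ telescopeι F (k + 1)) ≫ f := by
  rw [← assoc, ι_oneSubShift]

lemma oneSubShift_π_zero : oneSubShift F ≫ Sigma.π (telescopeTerm F) ⟨0⟩ =
    Sigma.π (telescopeTerm F) ⟨0⟩ := by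
  refine telescope_hom_ext fun k => ?_
  rw [ι_oneSubShift_assoc, Preadditive.sub_comp, assoc,
    Sigma.ι_π_of_ne (b := (⟨k + 1⟩ : ULift ℕ)) _ (by simp), comp_zero, sub_zero]

lemma oneSubShift_π_succ (n : ℕ) : oneSubShift F ≫ Sigma.π (telescopeTerm F) ⟨n + 1⟩ =
    Sigma.π (telescopeTerm F) ⟨n + 1⟩ - Sigma.π (telescopeTerm F) ⟨n⟩ ≫ transition F n := by
  refine telescope_hom_ext fun k => ?_
  rw [ι_oneSubShift_assoc, Preadditive.sub_comp, Preadditive.comp_sub, assoc]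
  congr 1
  by_cases h : k = n
  · subst h
    simp [Sigma.ι_π_eq_id_assoc]
  · rw [Sigma.ι_π_of_ne, Sigma.ι_π_of_ne_assoc, zero_comp, comp_zero] <;> simpa using h

/-- The zeroth component of `g` vanishes and each later one is the image of its predecessor.
Compactness is what lets the components determine `g`. -/
lemma eq_zero_of_comp_oneSubShift_eq_zero {c : T} (hc : compactObjects T c)
    (g : c ⟶ ∐ telescopeTerm F) (hg : g ≫ oneSubShift F = 0) : g = 0 := by
  have key : ∀ n, g ≫ Sigma.π (telescopeTerm F) ⟨n⟩ = 0 := by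
    intro n
    induction n with
    | zero => rw [← oneSubShift_π_zero, reassoc_of% hg, zero_comp]
    | succ n hn =>
      have := congrArg (g ≫ ·) (oneSubShift_π_succ F n)
      simpa [reassoc_of% hg, reassoc_of% hn] using this.symm
  obtain ⟨E, hE⟩ := exists_finset_forall_comp_sigmaπ_eq_zero hc _ g
  rw [Preadditive.comp_sub, comp_id, sub_eq_zero] at hE
  rw [hE, Preadditive.comp_sum]
  exact Finset.sum_eq_zero fun ⟨n⟩ _ => by rw [← assoc, key, zero_comp]

/-- The map from the coproduct of all terms to the `N`-th term that is given by the transition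
maps on the terms up to the `N`-th one. -/
noncomputable def toTerm (N : ℕ) : ∐ telescopeTerm F ⟶ F.obj N :=
  Sigma.desc fun k => if h : k.down ≤ N then F.map (homOfLE h) else 0

lemma ι_toTerm {k N : ℕ} (h : k ≤ N) : telescopeι F k ≫ toTerm F N = F.map (homOfLE h) := by
  simp [toTerm, h]

/-- Both terms of `1 - shift` agree once carried to stage `N`; the inequality is strict because the
summand `k + 1` must be carried there too. -/
lemma ι_oneSubShift_toTerm {k N : ℕ} (h : k < N) :
    telescopeι F k ≫ oneSubShift F ≫ toTerm F N = 0 := by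
  rw [ι_oneSubShift_assoc, Preadditive.sub_comp, assoc, ι_toTerm F h.le, ι_toTerm F h, sub_eq_zero,
    ← F.map_comp]
  rfl

variable [HasZeroObject T] [HasShift T ℤ] [∀ n : ℤ, (shiftFunctor T n).Additive]
  [Pretriangulated T]

/-- `H` is a homotopy colimit of the sequence `F` through the maps `j k : F k ⟶ H`. -/
structure IsTelescope (F : ℕ ⥤ T) (H : T) (j : ∀ k, F.obj k ⟶ H) : Prop where
  exists_distinguished : ∃ δ : H ⟶ (∐ telescopeTerm F)⟦(1 : ℤ)⟧,
    Triangle.mk (oneSubShift F) (telescopeDesc j) δ ∈ distTriang T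

lemma exists_isTelescope : ∃ (H : T) (j : ∀ k, F.obj k ⟶ H), IsTelescope F H j := by
  obtain ⟨H, i, δ, h⟩ := distinguished_cocone_triangle (oneSubShift F)
  refine ⟨H, fun k => telescopeι F k ≫ i, ⟨δ, ?_⟩⟩
  convert h
  exact telescope_hom_ext fun k => by simp

namespace IsTelescope

variable {F} {H : T} {j : ∀ k, F.obj k ⟶ H} (h : IsTelescope F H j)

include h

lemma transition_comp (k : ℕ) : transition F k ≫ j (k + 1) = j k := by
  obtain ⟨δ, hδ⟩ := h
  have := telescopeι F k ≫= distTriang_comp₁₂ hδ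
  rw [ι_oneSubShift_assoc, Preadditive.sub_comp, assoc] at this
  simpa [sub_eq_zero, eq_comm (a := j k)] using this

lemma map_comp {k l : ℕ} (hkl : k ≤ l) : F.map (homOfLE hkl) ≫ j l = j k := by
  induction l, hkl using Nat.le_induction with
  | base => simp [homOfLE_refl]
  | succ l hl ih =>
    rw [← ih, ← h.transition_comp l, ← F.map_comp_assoc]
    rfl

lemma exists_fac {c : T} (hc : compactObjects T c) (f : c ⟶ H) :
    ∃ (k : ℕ) (g : c ⟶ F.obj k), g ≫ j k = f := by
  obtain ⟨δ, hδ⟩ := h.1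
  -- Desuspended, `f ≫ δ` is a map from a compact object that `1 - shift` annihilates.
  have hf : f ≫ δ = 0 := by
    let e : c⟦(-1 : ℤ)⟧⟦(1 : ℤ)⟧ ≅ c := (shiftEquiv T (1 : ℤ)).counitIso.app c
    obtain ⟨g, hg⟩ := (shiftFunctor T (1 : ℤ)).map_surjective (e.hom ≫ f ≫ δ)
    have hg' : g = 0 := by
      apply eq_zero_of_comp_oneSubShift_eq_zero F ((compactObjects T).le_shift (-1 : ℤ) c hc)
      apply (shiftFunctor T (1 : ℤ)).map_injective
      have := distTriang_comp₃₁ hδ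
      rw [Functor.map_comp, hg, assoc, assoc, this, comp_zero, comp_zero, Functor.map_zero]
    rw [hg', Functor.map_zero] at hg
    rwa [← cancel_epi e.hom, comp_zero, eq_comm]
  obtain ⟨g, hg⟩ := distTriang_fac₂ hδ f hf
  obtain ⟨E, x, rfl⟩ := hc _ _ g
  let N := E.sup ULift.down
  refine ⟨N, ∑ k ∈ E, if hk : k.down ≤ N then x k ≫ F.map (homOfLE hk) else 0, ?_⟩
  rw [hg, Preadditive.sum_comp, Preadditive.sum_comp]
  refine Finset.sum_congr rfl fun k hk => ?_
  rw [dif_pos (Finset.le_sup hk), assoc, assoc, h.map_comp, ← ι_telescopeDesc j]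

lemma exists_map_eq_zero {c : T} (hc : compactObjects T c) {k : ℕ} (x : c ⟶ F.obj k)
    (hx : x ≫ j k = 0) : ∃ (l : ℕ) (hl : k ≤ l), x ≫ F.map (homOfLE hl) = 0 := by
  obtain ⟨δ, hδ⟩ := h.1
  obtain ⟨z, hz⟩ := distTriang_fac₁ hδ (x ≫ telescopeι F k) (by simpa using hx)
  obtain ⟨E, y, rfl⟩ := hc _ _ z
  have hk : k ≤ max k (E.sup ULift.down + 1) := le_max_left _ _
  refine ⟨_, hk, ?_⟩
  rw [← ι_toTerm, ← assoc, hz, Preadditive.sum_comp, Preadditive.sum_comp]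
  refine Finset.sum_eq_zero fun l hl => ?_
  have := ι_oneSubShift_toTerm F (k := l.down) (N := max k (E.sup ULift.down + 1))
    (lt_max_of_lt_right (Nat.lt_succ_of_le (Finset.le_sup (f := ULift.down) hl)))
  rw [assoc, assoc, this, comp_zero]

/-- This is the Milnor sequence: bijectivity identifies the limit of the groups `F k ⟶ Y` with the
group at `k = 0`, and surjectivity for the desuspension of `Y` kills `lim¹`. -/
lemma bijective_comp {Y : T} (hY : ∀ k, Function.Bijective
      (fun g : F.obj (k + 1) ⟶ Y => transition F k ≫ g))
    (hY' : ∀ k, Function.Surjective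
      (fun g : F.obj (k + 1) ⟶ Y⟦(-1 : ℤ)⟧ => transition F k ≫ g)) :
    Function.Bijective (fun g : H ⟶ Y => j 0 ≫ g) := by
  obtain ⟨δ, hδ⟩ := h.1
  constructor
  · suffices ∀ g : H ⟶ Y, j 0 ≫ g = 0 → g = 0 from fun g g' hg => by
      rw [← sub_eq_zero]
      exact this _ (by simpa [Preadditive.comp_sub, sub_eq_zero] using hg)
    intro g hg
    have hg' : ∀ k, j k ≫ g = 0 := by
      intro k
      induction k with
      | zero => exact hg
      | succ k hk => exact (hY k).1 (by simpa [reassoc_of% h.transition_comp k] using hk)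
    obtain ⟨w, hw⟩ := distTriang_desc₃ hδ g
      (telescope_hom_ext fun k => by simpa using hg' k)
    let e : Y⟦(-1 : ℤ)⟧⟦(1 : ℤ)⟧ ≅ Y := (shiftEquiv T (1 : ℤ)).counitIso.app Y
    obtain ⟨y, hy⟩ := (shiftFunctor T (1 : ℤ)).map_surjective (w ≫ e.inv)
    choose next hnext using fun k (a : F.obj k ⟶ Y⟦(-1 : ℤ)⟧) =>
      hY' k (a - telescopeι F k ≫ y)
    -- Solves the `lim¹` equation recursively; the starting value `0` is arbitrary.
    let y' : ∀ k, F.obj k ⟶ Y⟦(-1 : ℤ)⟧ := fun k => Nat.rec 0 next k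
    have hy' : oneSubShift F ≫ telescopeDesc y' = y := by
      refine telescope_hom_ext fun k => ?_
      rw [ι_oneSubShift_assoc, Preadditive.sub_comp, assoc, ι_telescopeDesc, ι_telescopeDesc]
      have : transition F k ≫ y' (k + 1) = y' k - telescopeι F k ≫ y := hnext k _
      rw [this, sub_sub_cancel]
    have hzero := distTriang_comp₃₁ hδ
    rw [← cancel_mono e.inv, hw, assoc, ← hy, ← hy', Functor.map_comp, reassoc_of% hzero,
      zero_comp, zero_comp]
  · intro g
    choose next hnext using fun k => (hY k).2
    let y : ∀ k, F.obj k ⟶ Y := fun k => Nat.rec g next k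
    obtain ⟨w, hw⟩ := distTriang_desc₂ hδ (telescopeDesc y) (by
      refine telescope_hom_ext fun k => ?_
      rw [ι_oneSubShift_assoc, Preadditive.sub_comp, assoc, ι_telescopeDesc, ι_telescopeDesc,
        comp_zero, sub_eq_zero]
      exact (hnext k _).symm)
    refine ⟨w, ?_⟩
    have := telescopeι F 0 ≫= hw
    exact (by simpa using this.symm : j 0 ≫ w = y 0)

end IsTelescope

end Telescope

end GeneratingHypothesis

namespace GeneratingHypothesis

/-! ### Localization by attaching cells -/

section CellularLocalization

variable {T : Type u} [Category.{v} T] [Preadditive T] [HasShift T ℤ] {I : Type v}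
  (G : I → T)

/-- The objects that receive only zero maps from the shifts of the objects of a family. -/
def cellLocal : ObjectProperty T := ((ObjectProperty.ofObj G).shiftClosure ℤ).rightOrthogonal

/-- The objects that have only zero maps to the objects which are local for a family. -/
def cellAcyclic : ObjectProperty T := (cellLocal G).leftOrthogonal

lemma cellLocal_iff (Y : T) : cellLocal G Y ↔ ∀ (i : I) (n : ℤ) (f : (G i)⟦n⟧ ⟶ Y), f = 0 := by
  constructor
  · intro h i n f
    exact h f ⟨G i, n, Iso.refl _, ⟨i⟩⟩
  · rintro h X f ⟨Z, n, e, ⟨i⟩⟩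
    rw [← cancel_epi e.inv, h i n (e.inv ≫ f), comp_zero]

lemma cellAcyclic_sigma [HasCoproducts.{v} T] {J : Type v} (X : J → T)
    (hX : ∀ j, cellAcyclic G (X j)) : cellAcyclic G (∐ X) :=
  fun _ f hY => Sigma.hom_ext _ _ fun j => by rw [hX j (Sigma.ι X j ≫ f) hY, comp_zero]

lemma cellAcyclic_obj (i : I) : cellAcyclic G (G i) := by
  intro Y f hY
  rw [cellLocal_iff] at hY
  rw [← cancel_epi ((shiftFunctorZero T ℤ).hom.app (G i)), comp_zero]
  exact hY i 0 _

variable [HasZeroObject T] [∀ n : ℤ, (shiftFunctor T n).Additive] [Pretriangulated T]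

instance : (cellLocal G).IsTriangulated :=
  inferInstanceAs ((ObjectProperty.ofObj G).shiftClosure ℤ).rightOrthogonal.IsTriangulated

instance : (cellLocal G).IsClosedUnderIsomorphisms :=
  inferInstanceAs
    ((ObjectProperty.ofObj G).shiftClosure ℤ).rightOrthogonal.IsClosedUnderIsomorphisms

instance : (cellAcyclic G).IsTriangulated :=
  inferInstanceAs (cellLocal G).leftOrthogonal.IsTriangulated

instance : (cellAcyclic G).IsClosedUnderIsomorphisms :=
  inferInstanceAs (cellLocal G).leftOrthogonal.IsClosedUnderIsomorphisms

lemma bijective_comp_of_trW {X X' Y : T} {f : X ⟶ X'} (hf : (cellAcyclic G).trW f)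
    (hY : cellLocal G Y) : Function.Bijective (fun g : X' ⟶ Y => f ≫ g) := by
  have : (cellAcyclic G).trW.isLocal Y := by
    rw [ObjectProperty.isLocal_trW]
    exact fun Z g hZ => hZ g hY
  exact this f hf

variable [HasCoproducts.{v} T]

/-- All maps from shifts of objects of a family to a given object. -/
abbrev Cells (X : T) : Type v := Σ x : I × ℤ, ((G x.1)⟦x.2⟧ ⟶ X)

/-- The source of the universal map from a coproduct of shifts of objects of a family. -/
noncomputable abbrev cellObj (X : T) : T := ∐ fun x : Cells G X => (G x.1.1)⟦x.1.2⟧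

lemma exists_attach (X : T) : ∃ (Y : T) (f : X ⟶ Y) (δ : Y ⟶ (cellObj G X)⟦(1 : ℤ)⟧),
    Triangle.mk (Sigma.desc fun x : Cells G X => x.2) f δ ∈ distTriang T :=
  distinguished_cocone_triangle _

/-- A sequence in which every term is obtained from the previous one by attaching all cells. -/
structure IsCellTower (F : ℕ ⥤ T) : Prop where
  exists_distinguished (k : ℕ) : ∃ δ : F.obj (k + 1) ⟶ (cellObj G (F.obj k))⟦(1 : ℤ)⟧,
    Triangle.mk (Sigma.desc fun x : Cells G (F.obj k) => x.2) (transition F k) δ ∈ distTriang T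

lemma exists_isCellTower (X : T) : ∃ F : ℕ ⥤ T, F.obj 0 = X ∧ IsCellTower G F := by
  choose Y f δ h using exists_attach G
  let Z : ℕ → T := fun n => Nat.rec X (fun _ => Y) n
  let F : ℕ ⥤ T := Functor.ofSequence (X := Z) fun n => f (Z n)
  refine ⟨F, rfl, ⟨fun k => ⟨δ (Z k), ?_⟩⟩⟩
  have : transition F k = f (Z k) := Functor.ofSequence_map_homOfLE_succ _ _
  rw [this]
  exact h (Z k)

variable {G}

namespace IsCellTower

variable {F : ℕ ⥤ T} (hF : IsCellTower G F)

include hF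

lemma comp_transition (k : ℕ) (i : I) (n : ℤ) (f : (G i)⟦n⟧ ⟶ F.obj k) :
    f ≫ transition F k = 0 := by
  obtain ⟨δ, hδ⟩ := hF.exists_distinguished k
  have : Sigma.ι (fun x : Cells G (F.obj k) => (G x.1.1)⟦x.1.2⟧) ⟨(i, n), f⟩ ≫
      Sigma.desc (fun x : Cells G (F.obj k) => x.2) = f := Sigma.ι_desc _ _
  rw [← this, assoc, distTriang_comp₁₂ hδ, comp_zero]

lemma trW_transition (k : ℕ) : (cellAcyclic G).trW (transition F k) := by
  obtain ⟨δ, hδ⟩ := hF.exists_distinguished k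
  exact ObjectProperty.trW.mk' (cellAcyclic G) hδ
    (cellAcyclic_sigma G _ fun x => (cellAcyclic G).le_shift x.1.2 _ (cellAcyclic_obj G x.1.1))

variable {H : T} {j : ∀ k, F.obj k ⟶ H} (h : IsTelescope F H j)

include h

/-- A map from a compact cell factors through a finite stage, and the next stage kills it. -/
lemma cellLocal (hG : ∀ i, compactObjects T (G i)) : cellLocal G H := by
  rw [cellLocal_iff]
  intro i n f
  obtain ⟨k, g, rfl⟩ := h.exists_fac ((compactObjects T).le_shift n _ (hG i)) f
  rw [← h.transition_comp, reassoc_of% (hF.comp_transition k i n g), zero_comp]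

lemma bijective_comp {Y : T} (hY : GeneratingHypothesis.cellLocal G Y) :
    Function.Bijective (fun g : H ⟶ Y => j 0 ≫ g) :=
  h.bijective_comp (fun k => bijective_comp_of_trW G (hF.trW_transition k) hY)
    (fun k => (bijective_comp_of_trW G (hF.trW_transition k)
      ((GeneratingHypothesis.cellLocal G).le_shift _ _ hY)).2)

end IsCellTower

/-- Only finitely many summands are hit, and `R` contains their product even when it lacks the whole
coproduct. -/
lemma exists_fac_of_compact (R : ObjectProperty T) [R.IsTriangulated]
    [R.IsClosedUnderIsomorphisms] {c : T} (hc : compactObjects T c) {J : Type v} (X : J → T)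
    (hX : ∀ j, R (X j)) (f : c ⟶ ∐ X) :
    ∃ (B : T) (a : c ⟶ B) (b : B ⟶ ∐ X), R B ∧ a ≫ b = f := by
  classical
  obtain ⟨F, g, rfl⟩ := hc _ _ f
  refine ⟨∏ᶜ fun j : F => X j, Pi.lift fun j => g j, ∑ j : F, Pi.π _ j ≫ Sigma.ι X j.1,
    R.prop_pi _ fun j => hX j, ?_⟩
  simp only [Preadditive.comp_sum, Pi.lift_π_assoc]
  exact Finset.sum_coe_sort F fun j => g j ≫ Sigma.ι X j

lemma exists_shift_fac_of_compact (R : ObjectProperty T) [R.IsTriangulated]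
    [R.IsClosedUnderIsomorphisms] {c : T} (hc : compactObjects T c) {J : Type v} (X : J → T)
    (hX : ∀ j, R (X j)) (f : c ⟶ (∐ X)⟦(1 : ℤ)⟧) :
    ∃ (B : T) (a : c ⟶ B⟦(1 : ℤ)⟧) (b : B ⟶ ∐ X), R B ∧ a ≫ b⟦1⟧' = f := by
  let e : c⟦(-1 : ℤ)⟧⟦(1 : ℤ)⟧ ≅ c := (shiftEquiv T (1 : ℤ)).counitIso.app c
  obtain ⟨g, hg⟩ := (shiftFunctor T (1 : ℤ)).map_surjective (e.hom ≫ f)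
  obtain ⟨B, a, b, hB, rfl⟩ :=
    exists_fac_of_compact R ((compactObjects T).le_shift (-1 : ℤ) c hc) X hX g
  refine ⟨B, e.inv ≫ a⟦1⟧', b, hB, ?_⟩
  rw [assoc, ← Functor.map_comp, hg, e.inv_hom_id_assoc]

/-- A map from a compact object to a term of a tower lifts to the first term, up to a map of
compact objects with acyclic cone. -/
lemma IsCellTower.exists_lift [IsTriangulated T] (Q : ObjectProperty T) [Q.IsTriangulated]
    [Q.IsClosedUnderIsomorphisms] (hQ : Q ≤ compactObjects T) (hG : ∀ i, Q (G i)) {F : ℕ ⥤ T}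
    (hF : IsCellTower G F) (k : ℕ) : ∀ {c : T} (_ : Q c) (f : c ⟶ F.obj k),
      ∃ (c' : T) (u : c' ⟶ c) (v : c' ⟶ F.obj 0), Q c' ∧ (cellAcyclic G).trW u ∧
        v ≫ F.map (homOfLE (Nat.zero_le k)) = u ≫ f := by
  induction k with
  | zero =>
    intro c hc f
    refine ⟨c, 𝟙 c, f, hc, (cellAcyclic G).trW.id_mem c, ?_⟩
    rw [show homOfLE (Nat.zero_le 0) = 𝟙 0 from rfl, F.map_id, comp_id, id_comp]
  | succ k ih =>
    intro c hc f
    obtain ⟨δ, hδ⟩ := hF.exists_distinguished k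
    -- The obstruction `f ≫ δ` to lifting `f` one stage down factors through `ΣB` with `B` acyclic
    -- and in `Q`. Passing to the fibre `c₁` of `a` removes it, and `c₁ ⟶ c` has cone `ΣB`.
    obtain ⟨B, a, b, hB, hab⟩ := exists_shift_fac_of_compact (Q ⊓ cellAcyclic G) (hQ c hc)
      (fun x : Cells G (F.obj k) => (G x.1.1)⟦x.1.2⟧)
      (fun x => (Q ⊓ cellAcyclic G).le_shift x.1.2 _ ⟨hG _, cellAcyclic_obj G _⟩) (f ≫ δ)
    obtain ⟨c₁, u, w, hu⟩ := distinguished_cocone_triangle₁ a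
    have hB' := (Q ⊓ cellAcyclic G).le_shift (1 : ℤ) _ hB
    have hc₁ : Q c₁ := Q.ext_of_isTriangulatedClosed₁ _ hu hc hB'.1
    obtain ⟨g, hg⟩ := distTriang_fac₂ hδ (u ≫ f) (by
      rw [assoc, ← hab, reassoc_of% (distTriang_comp₁₂ hu), zero_comp])
    obtain ⟨c', u', v, hc', hu', hv⟩ := ih hc₁ g
    refine ⟨c', u' ≫ u, v, hc', (cellAcyclic G).trW.comp_mem _ _ hu'
      (ObjectProperty.trW.mk _ hu hB'.2), ?_⟩
    rw [assoc, hg, ← reassoc_of% hv, ← F.map_comp]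
    rfl

end CellularLocalization

end GeneratingHypothesis

namespace GeneratingHypothesis

/-! ### The graded action on homotopy -/

section Action

variable {T : Type u} [Category.{v} T] [HasShift T ℤ] {S X Y : T}

lemma act_act {m n r k k' l : ℤ} (x : HomotopyGroup S X m) (a : HomotopyGroup S S n)
    (b : HomotopyGroup S S r) (h : n + m = k) (h' : r + k = l) (h'' : r + n = k')
    (h''' : k' + m = l) : act (act x a k h) b l h' = act x (act a b k' h'') l h''' := by
  simp only [act, Functor.map_comp, assoc]
  have := shiftFunctorAdd'_assoc_hom_app r n m k' k l h'' h (by lia) S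
  rw [reassoc_of% this]
  congr 1
  exact ((shiftFunctorAdd' T n m k h).hom.naturality_assoc b _)

lemma act_comp {m n k : ℤ} (x : HomotopyGroup S X m) (a : HomotopyGroup S S n) (h : n + m = k)
    (f : X ⟶ Y) : act x a k h ≫ f = act (X := Y) (x ≫ f) a k h := by
  simp [act]

lemma bijective_act_iff {m n k : ℤ} (a : HomotopyGroup S S n) (h : n + m = k) :
    Function.Bijective (fun x : HomotopyGroup S X m => act x a k h) ↔
      Function.Bijective (fun x : S⟦m⟧ ⟶ X => a⟦m⟧' ≫ x) :=
  Function.Bijective.of_comp_iff'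
    (((shiftFunctorAdd' T n m k h).app S).homFromEquiv (Z := X)).symm.bijective
    (fun x : S⟦m⟧ ⟶ X => a⟦m⟧' ≫ x)

lemma PrimeIdeal.act_notMem [Preadditive T] (p : PrimeIdeal S) {m n k : ℤ}
    {a : HomotopyGroup S S m} {b : HomotopyGroup S S n} (ha : a ∉ p.part m) (hb : b ∉ p.part n)
    (h : n + m = k) : act a b k h ∉ p.part k :=
  fun hab => (p.mem_or_mem a b k h hab).elim ha hb

lemma exists_unshift {A : T} {m j : ℤ} (x : S⟦m⟧ ⟶ A⟦j⟧) : ∃ y : S⟦m - j⟧ ⟶ A,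
    x = (shiftFunctorAdd' T (m - j) j m (sub_add_cancel m j)).hom.app S ≫ y⟦j⟧' := by
  obtain ⟨y, hy⟩ := (shiftFunctor T j).map_surjective
    ((shiftFunctorAdd' T (m - j) j m (sub_add_cancel m j)).inv.app S ≫ x)
  refine ⟨y, ?_⟩
  rw [hy, Iso.hom_inv_id_app_assoc]

variable [Preadditive T]

lemma act_zero {m n k : ℤ} (a : HomotopyGroup S S n) (h : n + m = k) :
    act (0 : HomotopyGroup S X m) a k h = 0 := by
  simp [act]

lemma act_add {m n k : ℤ} (x y : HomotopyGroup S X m) (a : HomotopyGroup S S n) (h : n + m = k) :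
    act (x + y) a k h = act x a k h + act y a k h := by
  simp [act]

lemma act_eq_zero_iff {m n k : ℤ} (x : HomotopyGroup S X m) (a : HomotopyGroup S S n)
    (h : n + m = k) : act x a k h = 0 ↔ a⟦m⟧' ≫ x = 0 := by
  simp only [act]
  exact Preadditive.IsIso.comp_left_eq_zero _ _

lemma IsGradedCommutative.act_comm (hS : IsGradedCommutative S) {m n k : ℤ}
    (a : HomotopyGroup S S m) (b : HomotopyGroup S S n) (h : n + m = k) (h' : m + n = k) :
    act a b k h = (m * n).negOnePow • act b a k h' := by
  subst h'
  exact hS m n a b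

lemma IsGradedCommutative.act_eq_zero_comm (hS : IsGradedCommutative S) {m n k : ℤ}
    {a : HomotopyGroup S S m} {b : HomotopyGroup S S n} (h : n + m = k) (h' : m + n = k) :
    act a b k h = 0 ↔ act b a k h' = 0 := by
  rw [hS.act_comm a b h h', smul_eq_zero_iff_eq]

variable [∀ n : ℤ, (shiftFunctor T n).Additive]

lemma shift_comp_unshift_eq_zero_iff {A : T} {m j n : ℤ} (y : S⟦m - j⟧ ⟶ A) (t : S⟦n⟧ ⟶ S) :
    t⟦m⟧' ≫ (shiftFunctorAdd' T (m - j) j m (sub_add_cancel m j)).hom.app S ≫ y⟦j⟧' = 0 ↔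
      t⟦m - j⟧' ≫ y = 0 := by
  rw [(shiftFunctorAdd' T (m - j) j m (sub_add_cancel m j)).hom.naturality_assoc t,
    Preadditive.IsIso.comp_left_eq_zero, Functor.comp_map, ← Functor.map_comp,
    Functor.map_eq_zero_iff]

lemma unshift_comp_eq_zero_iff {A B : T} {m j : ℤ} (y : S⟦m - j⟧ ⟶ A) (z : A ⟶ B) :
    ((shiftFunctorAdd' T (m - j) j m (sub_add_cancel m j)).hom.app S ≫ y⟦j⟧') ≫ z⟦j⟧' = 0 ↔
      y ≫ z = 0 := by
  rw [assoc, Preadditive.IsIso.comp_left_eq_zero, ← Functor.map_comp, Functor.map_eq_zero_iff]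

end Action

/-! ### Torsion homotopy at a prime -/

section Torsion

variable {T : Type u} [Category.{v} T] [HasShift T ℤ] [Preadditive T] {S X Y : T}
  (p : PrimeIdeal S)

/-- A homogeneous element of `π_* X` is torsion if it is killed by a homogeneous element outside
the prime ideal. -/
def IsTorsion {m : ℤ} (x : HomotopyGroup S X m) : Prop :=
  ∃ (n : ℤ) (s : HomotopyGroup S S n), s ∉ p.part n ∧ act x s (n + m) rfl = 0

variable {p}

lemma IsTorsion.comp {m : ℤ} {x : HomotopyGroup S X m} (hx : IsTorsion p x) (f : X ⟶ Y) :
    IsTorsion p (X := Y) (x ≫ f) := by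
  obtain ⟨n, s, hs, h⟩ := hx
  exact ⟨n, s, hs, by rw [← act_comp, h, zero_comp]⟩

lemma IsTorsion.of_act {m n k : ℤ} {x : HomotopyGroup S X m} {s : HomotopyGroup S S n}
    (hs : s ∉ p.part n) {h : n + m = k} (hx : IsTorsion p (act x s k h)) : IsTorsion p x := by
  obtain ⟨r, t, ht, hrt⟩ := hx
  refine ⟨r + n, act s t _ rfl, p.act_notMem hs ht _, ?_⟩
  rwa [act_act (k' := r + n) (h'' := rfl) (h''' := by lia), act_eq_zero_iff,
    ← act_eq_zero_iff (h := rfl)] at hrt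

lemma isTorsion_zero (m : ℤ) : IsTorsion p (0 : HomotopyGroup S X m) :=
  ⟨0, unit S, p.unit_notMem, act_zero _ _⟩

lemma IsTorsion.add [∀ n : ℤ, (shiftFunctor T n).Additive] (hS : IsGradedCommutative S) {m : ℤ}
    {x y : HomotopyGroup S X m} (hx : IsTorsion p x) (hy : IsTorsion p y) :
    IsTorsion p (x + y) := by
  obtain ⟨n, s, hs, hxs⟩ := hx
  obtain ⟨r, t, ht, hyt⟩ := hy
  refine .of_act (h := rfl) hs (.of_act (h := rfl) ht ⟨0, unit S, p.unit_notMem, ?_⟩)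
  -- Commuting `s` past `t` costs only a sign and brings `y · t = 0` to the front.
  have key : act (act y s (n + m) rfl) t (r + (n + m)) rfl = 0 := by
    rw [act_act (k' := r + n) (h'' := rfl) (h''' := by lia)]
    rw [hS.act_comm s t rfl (add_comm n r)]
    have h' : act y (act t s (r + n) (add_comm n r)) (r + (n + m)) (by lia) = 0 := by
      rw [← act_act (k := r + m) (h := rfl) (h' := by lia), hyt, act_zero]
    rw [act_eq_zero_iff] at h' ⊢
    rw [Functor.map_units_smul, Linear.units_smul_comp, h', smul_zero]
  rw [act_add, act_add, hxs, act_zero, key, add_zero, act_zero]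

lemma IsTorsion.sum [∀ n : ℤ, (shiftFunctor T n).Additive] (hS : IsGradedCommutative S) {m : ℤ}
    {J : Type*} (F : Finset J) (x : J → HomotopyGroup S X m)
    (hx : ∀ j ∈ F, IsTorsion p (x j)) : IsTorsion p (∑ j ∈ F, x j) :=
  Finset.sum_induction _ (IsTorsion p) (fun _ _ => .add hS) (isTorsion_zero m) hx

variable (p) in
/-- The objects all of whose homotopy is torsion. -/
def torsionObjects : ObjectProperty T := fun A => ∀ (m : ℤ) (x : HomotopyGroup S A m), IsTorsion p x

variable [∀ n : ℤ, (shiftFunctor T n).Additive]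

instance : (torsionObjects p).IsStableUnderShift ℤ where
  isStableUnderShiftBy j :=
    { le_shift := by
        intro A hA m x
        obtain ⟨y, rfl⟩ := exists_unshift x
        obtain ⟨n, s, hs, h⟩ := hA _ y
        refine ⟨n, s, hs, ?_⟩
        rw [act_eq_zero_iff] at h ⊢
        exact (shift_comp_unshift_eq_zero_iff y s).2 h }

lemma torsionObjects_sigma [HasCoproducts.{v} T] (hcompact : IsCompactObject S)
    (hS : IsGradedCommutative S) {J : Type v} (A : J → T) (hA : ∀ j, torsionObjects p (A j)) :
    torsionObjects p (∐ A) := by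
  intro m x
  obtain ⟨F, g, rfl⟩ := (compactObjects T).le_shift m _ hcompact.compactObjects J A x
  exact .sum hS _ _ fun j _ => (hA j m (g j)).comp _

variable [HasZeroObject T] [Pretriangulated T]

/-- Two applications of `s` kill `x`. The image of `x` under `h` composes to zero with `s`, so by
commutativity `s` also kills it from the right and `x · s` comes from some `w` in `π_* S`. Then `w ·
s = ± s · w` dies in `C`. One application need not suffice. -/
lemma torsionObjects_cone (hS : IsGradedCommutative S) {n : ℤ} {s : S⟦n⟧ ⟶ S} (hs : s ∉ p.part n)
    {C : T} {g : S ⟶ C} {h : C ⟶ S⟦n⟧⟦(1 : ℤ)⟧} (H : Triangle.mk s g h ∈ distTriang T) :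
    torsionObjects p C := by
  intro m x
  have hxh : s⟦m⟧' ≫ x ≫ h = 0 := by
    obtain ⟨y, hy⟩ := exists_unshift (x ≫ h)
    rw [hy, shift_comp_unshift_eq_zero_iff]
    have hys : y ≫ s = 0 := by
      rw [← unshift_comp_eq_zero_iff, ← hy, assoc, distTriang_comp₃₁ H, comp_zero]
    obtain ⟨z, rfl⟩ := exists_unshift y
    rw [shift_comp_unshift_eq_zero_iff,
      ← act_eq_zero_iff (h := add_sub_cancel n (m - 1)),
      hS.act_eq_zero_comm (h' := sub_add_cancel (m - 1) n)]
    simpa [act] using hys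
  obtain ⟨w, hw⟩ := distTriang_fac₂ H (s⟦m⟧' ≫ x) (by rw [assoc, hxh])
  refine .of_act (h := rfl) hs ⟨n, s, hs, ?_⟩
  let w' : HomotopyGroup S S (n + m) := (shiftFunctorAdd' T n m (n + m) rfl).hom.app S ≫ w
  have h₁ : act x s (n + m) rfl = w' ≫ g := by
    rw [assoc, ← hw, act]
  have h₃ : act s w' (n + (n + m)) (add_comm _ _) ≫ g = 0 := by
    rw [act, assoc, assoc, distTriang_comp₁₂ H, comp_zero, comp_zero]
  rw [h₁, ← act_comp, hS.act_comm w' s rfl (add_comm _ _), Linear.units_smul_comp, h₃, smul_zero]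

end Torsion

end GeneratingHypothesis

namespace GeneratingHypothesis

/-! ### Homotopy of the tower built from cones of elements outside the prime -/

section PrimeCones

variable {T : Type u} [Category.{v} T] [HasShift T ℤ] [Preadditive T] [HasZeroObject T]
  [∀ n : ℤ, (shiftFunctor T n).Additive] [Pretriangulated T] {S : T} (p : PrimeIdeal S)

/-- The homogeneous elements outside a prime ideal. -/
abbrev PrimeIdeal.Compl : Type v := Σ n : ℤ, { s : S⟦n⟧ ⟶ S // s ∉ p.part n }

/-- The cone of a homogeneous element outside a prime ideal. -/
noncomputable def primeCone (i : p.Compl) : T := (distinguished_cocone_triangle i.2.1).choose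

lemma exists_primeCone_distinguished (i : p.Compl) :
    ∃ (g : S ⟶ primeCone p i) (h : primeCone p i ⟶ S⟦i.1⟧⟦(1 : ℤ)⟧),
      Triangle.mk i.2.1 g h ∈ distTriang T :=
  (distinguished_cocone_triangle i.2.1).choose_spec

lemma thickSubcategory_primeCone [IsTriangulated T] (i : p.Compl) :
    thickSubcategory S (primeCone p i) := by
  obtain ⟨g, h, H⟩ := exists_primeCone_distinguished p i
  have hS : thickSubcategory S S := ObjectProperty.le_triangEnvelope _ _ ⟨()⟩
  exact (thickSubcategory S).ext_of_isTriangulatedClosed₃ _ H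
    ((thickSubcategory S).le_shift i.1 _ hS) hS

lemma trW_shift_of_notMem {n : ℤ} {s : S⟦n⟧ ⟶ S} (hs : s ∉ p.part n) (m : ℤ) :
    (cellAcyclic (primeCone p)).trW (s⟦m⟧') := by
  obtain ⟨g, h, H⟩ := exists_primeCone_distinguished p ⟨n, s, hs⟩
  exact (ObjectProperty.trW.mk _ H (cellAcyclic_obj (primeCone p) ⟨n, s, hs⟩)).shift m

lemma cellLocal_primeCone_iff (Y : T) : cellLocal (primeCone p) Y ↔
    ∀ (n : ℤ) (s : S⟦n⟧ ⟶ S), s ∉ p.part n → ∀ m : ℤ,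
      Function.Bijective (fun y : S⟦m⟧ ⟶ Y => s⟦m⟧' ≫ y) := by
  constructor
  · intro hY n s hs m
    exact bijective_comp_of_trW _ (trW_shift_of_notMem p hs m) hY
  · intro h
    rw [cellLocal_iff]
    intro i k f
    obtain ⟨g, δ, H⟩ := exists_primeCone_distinguished p i
    have H' : Triangle.mk (k.negOnePow • i.2.1⟦k⟧') (k.negOnePow • g⟦k⟧')
        (k.negOnePow • δ⟦k⟧' ≫ (shiftFunctorComm T 1 k).hom.app _) ∈ distTriang T :=
      Triangle.shift_distinguished _ H k
    have hg : g⟦k⟧' ≫ f = 0 := (h i.1 i.2.1 i.2.2 k).1 (by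
      dsimp only
      rw [← assoc, ← Functor.map_comp, distTriang_comp₁₂ H, Functor.map_zero, zero_comp, comp_zero])
    obtain ⟨w, rfl⟩ := distTriang_desc₃ H' f (by rw [Linear.units_smul_comp, hg, smul_zero])
    -- Injectivity in degree `k` made `f` factor through the connecting map; surjectivity in degree
    -- `k + 1` now factors `w` through the suspension of `s`, which that map annihilates.
    obtain ⟨y, hy⟩ := (h i.1 i.2.1 i.2.2 (k + 1)).2 ((shiftFunctorAdd T k 1).hom.app _ ≫ w)
    have hw : w = (i.2.1⟦k⟧')⟦(1 : ℤ)⟧' ≫ (shiftFunctorAdd T k 1).inv.app S ≫ y := by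
      rw [← cancel_epi ((shiftFunctorAdd T k 1).hom.app (S⟦i.1⟧)), ← hy]
      have := (shiftFunctorAdd T k 1).hom.naturality i.2.1
      dsimp only [Functor.comp_map] at this
      rw [← reassoc_of% this, Iso.hom_inv_id_app_assoc]
    have h₀ := distTriang_comp₃₁ H'
    rw [Functor.map_units_smul, Linear.comp_units_smul, smul_eq_zero_iff_eq] at h₀
    rw [hw, reassoc_of% h₀, zero_comp]

variable {p} [HasCoproducts.{v} T] (hcompact : IsCompactObject S) (hS : IsGradedCommutative S)
  {F : ℕ ⥤ T} (hF : IsCellTower (primeCone p) F)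

include hcompact hS

lemma torsionObjects_cellObj (X : T) : torsionObjects p (cellObj (primeCone p) X) := by
  refine torsionObjects_sigma hcompact hS _ fun x => (torsionObjects p).le_shift x.1.2 _ ?_
  obtain ⟨g, h, H⟩ := exists_primeCone_distinguished p x.1.1
  exact torsionObjects_cone hS x.1.1.2.2 H

include hF

/-- The kernel of a transition is the image of the homotopy of the attached cells, which is torsion.
-/
lemma IsTorsion.of_comp_transition {m : ℤ} {k : ℕ} {x : HomotopyGroup S (F.obj k) m}
    (hx : IsTorsion p (X := F.obj (k + 1)) (x ≫ transition F k)) : IsTorsion p x := by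
  obtain ⟨n, s, hs, h⟩ := hx
  obtain ⟨δ, hδ⟩ := hF.exists_distinguished k
  rw [← act_comp] at h
  obtain ⟨y, hy⟩ := distTriang_fac₁ hδ _ h
  refine .of_act (h := rfl) hs ?_
  rw [hy]
  exact (torsionObjects_cellObj hcompact hS _ _ y).comp _

lemma IsTorsion.of_comp_map {m : ℤ} {k l : ℕ} (hkl : k ≤ l) {x : HomotopyGroup S (F.obj k) m}
    (hx : IsTorsion p (X := F.obj l) (x ≫ F.map (homOfLE hkl))) : IsTorsion p x := by
  induction l, hkl using Nat.le_induction with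
  | base => simpa [show homOfLE (le_refl k) = 𝟙 k from rfl] using hx
  | succ l hl ih =>
    apply ih
    apply IsTorsion.of_comp_transition hcompact hS hF
    rw [assoc, ← F.map_comp]
    exact hx

/-- The obstruction to lifting `y` one stage down lies in the torsion homotopy of suspended cells,
so each stage costs one denominator. -/
lemma exists_act_lift (k : ℕ) : ∀ {m : ℤ} (y : HomotopyGroup S (F.obj k) m),
    ∃ (n l : ℤ) (h : n + m = l) (s : HomotopyGroup S S n) (x : HomotopyGroup S (F.obj 0) l),
      s ∉ p.part n ∧ x ≫ F.map (homOfLE (Nat.zero_le k)) = act y s l h := by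
  induction k with
  | zero =>
    intro m y
    refine ⟨0, _, rfl, unit S, act y (unit S) _ rfl, p.unit_notMem, ?_⟩
    rw [show homOfLE (Nat.zero_le 0) = 𝟙 0 from rfl, F.map_id, comp_id]
  | succ k ih =>
    intro m y
    obtain ⟨δ, hδ⟩ := hF.exists_distinguished k
    obtain ⟨n, s, hs, h⟩ := (torsionObjects p).le_shift (1 : ℤ) _
      (torsionObjects_cellObj hcompact hS (p := p) (F.obj k)) m (y ≫ δ)
    rw [← act_comp] at h
    obtain ⟨z, hz⟩ := distTriang_fac₂ hδ _ h
    obtain ⟨r, l, hl, t, x, ht, hx⟩ := ih z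
    refine ⟨r + n, l, by lia, act s t _ rfl, x, p.act_notMem hs ht _, ?_⟩
    have hx' : (x ≫ F.map (homOfLE (Nat.zero_le k))) ≫ transition F k =
        act (X := F.obj (k + 1)) (z ≫ transition F k) t l hl := by
      rw [hx, act_comp]
    rw [← hz, act_act (k' := r + n) (h'' := rfl) (h''' := by lia), assoc, ← F.map_comp] at hx'
    exact hx'

lemma IsCellTower.isLocalizationAt {H : T} {j : ∀ k, F.obj k ⟶ H} (h : IsTelescope F H j)
    (hH : GeneratingHypothesis.cellLocal (primeCone p) H) : IsLocalizationAt p (j 0) where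
  bijective m n s hs := by
    rw [bijective_act_iff]
    exact (cellLocal_primeCone_iff p H).1 hH n s hs m
  surj m y := by
    obtain ⟨k, z, rfl⟩ := h.exists_fac ((compactObjects T).le_shift m _ hcompact.compactObjects) y
    obtain ⟨n, _, rfl, s, x, hs, hx⟩ := exists_act_lift hcompact hS hF k z
    refine ⟨n, s, x, hs, ?_⟩
    rw [← act_comp, ← hx, assoc, h.map_comp]
  exists_of_eq_zero m x hx := by
    obtain ⟨l, hl, hxl⟩ := h.exists_map_eq_zero
      ((compactObjects T).le_shift m _ hcompact.compactObjects) x hx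
    refine IsTorsion.of_comp_map hcompact hS hF hl ?_
    rw [hxl]
    exact isTorsion_zero _

end PrimeCones

end GeneratingHypothesis

namespace GeneratingHypothesis

/-! ### From reflections to localization functors -/

section Reflection

variable {T : Type u} [Category.{v} T] [HasShift T ℤ]

lemma bijective_shift_comp {A B Z : T} (f : A ⟶ B) (n : ℤ)
    (h : Function.Bijective (fun g : B ⟶ Z⟦-n⟧ => f ≫ g)) :
    Function.Bijective (fun g : B⟦n⟧ ⟶ Z => f⟦n⟧' ≫ g) := by
  let adj : shiftFunctor T n ⊣ shiftFunctor T (-n) := (shiftEquiv T n).toAdjunction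
  refine (Function.Bijective.of_comp_iff' (adj.homEquiv A Z).bijective _).1 ?_
  convert h.comp (adj.homEquiv B Z).bijective using 1
  ext g
  exact adj.homEquiv_naturality_left f g

variable [Preadditive T] [HasZeroObject T] [∀ n : ℤ, (shiftFunctor T n).Additive]
  [Pretriangulated T]

/-- The localization functor given by reflections in a triangulated subcategory. -/
lemma exists_localizationFunctor (P : ObjectProperty T) [P.IsTriangulated] (H : T → T)
    (η : ∀ X, X ⟶ H X) (hH : ∀ X, P (H X))
    (hη : ∀ X Y, P Y → Function.Bijective (fun g : H X ⟶ Y => η X ≫ g)) :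
    ∃ (L : LocalizationFunctor T) (e : ∀ X, L.functor.obj X = H X),
      ∀ X, L.ι.app X = η X ≫ eqToHom (e X).symm := by
  let equiv : ∀ (X : T) (Y : P.FullSubcategory), ((⟨H X, hH X⟩ : P.FullSubcategory) ⟶ Y) ≃
      (X ⟶ P.ι.obj Y) := fun X Y =>
    P.fullyFaithfulι.homEquiv.trans (Equiv.ofBijective _ (hη X Y.obj Y.property))
  let adj := Adjunction.adjunctionOfEquivLeft equiv (fun X Y Y' g h => (assoc _ _ _).symm)
  -- The reflector is left adjoint to an exact inclusion, and so inherits shift compatibility and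
  -- exactness.
  let := adj.leftAdjointCommShift ℤ
  have := adj.commShift_of_rightAdjoint ℤ
  have := adj.isTriangulated_leftAdjoint
  let L : T ⥤ T := Adjunction.leftAdjointOfEquiv equiv
    (fun X Y Y' g h => (assoc _ _ _).symm) ⋙ P.ι
  have hunit : ∀ X, adj.unit.app X = η X := fun X => by
    exact (Adjunction.adjunctionOfEquivLeft_unit_app equiv _ X).trans (comp_id (η X))
  have hiso : ∀ X, P X → IsIso (η X) := fun X hX => by
    obtain ⟨r, hr⟩ := (hη X X hX).2 (𝟙 X)
    dsimp only at hr
    exact ⟨r, hr, (hη X _ (hH X)).1 (by simp [reassoc_of% hr])⟩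
  refine ⟨{ functor := L, ι := adj.unit, isIso_map_ι := fun X => ?_,
            bijective_precomp := fun X Y n => ?_ }, fun X => rfl, fun X => ?_⟩
  · have hmap : L.map (η X) = η (H X) := (hη X _ (hH _)).1 (by
      have := adj.unit.naturality (η X)
      rw [hunit, hunit] at this
      exact this.symm)
    rw [hunit, hmap]
    exact hiso _ (hH X)
  · rw [hunit]
    exact bijective_shift_comp _ n (hη Y _ (P.le_shift (-n) _ (hH X)))
  · rw [eqToHom_refl, comp_id]
    exact hunit X

end Reflection

/-! ### Existence of the localization at a prime -/

section Existence

variable {T : Type u} [Category.{v} T] [Preadditive T] [HasZeroObject T] [HasShift T ℤ]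
  [∀ n : ℤ, (shiftFunctor T n).Additive] [Pretriangulated T] [IsTriangulated T]
  [HasCoproducts.{v} T] {S : T}

lemma primeCone_compact (hcompact : IsCompactObject S) (p : PrimeIdeal S) (i : p.Compl) :
    compactObjects T (primeCone p i) :=
  thickSubcategory_le_compactObjects hcompact _ (thickSubcategory_primeCone p i)

theorem exists_localizationFunctor_isLocalizationAtPrime (hcompact : IsCompactObject S)
    (hS : IsGradedCommutative S) (p : PrimeIdeal S) :
    ∃ L : LocalizationFunctor T, L.IsLocalizationAtPrime p := by
  have key : ∀ X : T, ∃ (H : T) (η : X ⟶ H), cellLocal (primeCone p) H ∧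
      (∀ Y, cellLocal (primeCone p) Y → Function.Bijective (fun g : H ⟶ Y => η ≫ g)) ∧
      IsLocalizationAt p η := by
    intro X
    obtain ⟨F, rfl, hF⟩ := exists_isCellTower (primeCone p) X
    obtain ⟨H, j, hj⟩ := exists_isTelescope F
    have hH := hF.cellLocal hj (primeCone_compact hcompact p)
    exact ⟨H, j 0, hH, fun Y hY => hF.bijective_comp hj hY, hF.isLocalizationAt hcompact hS hj hH⟩
  choose H η hH hη hloc using key
  obtain ⟨L, e, he⟩ := exists_localizationFunctor (cellLocal (primeCone p)) H η hH hη
  refine ⟨L, fun X => ?_⟩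
  have : ∀ {Z : T} (e : Z = H X) (f : X ⟶ Z), f = η X ≫ eqToHom e.symm → IsLocalizationAt p f := by
    rintro Z rfl f rfl
    simpa using hloc X
  exact this (e X) _ (he X)

end Existence

end GeneratingHypothesis

namespace GeneratingHypothesis

/-! ### Detection of isomorphisms by homotopy -/

section Generation

variable {T : Type u} [Category.{v} T] [Preadditive T] [HasZeroObject T] [HasShift T ℤ]
  [∀ n : ℤ, (shiftFunctor T n).Additive] [Pretriangulated T] {S : T}

/-- Objects with no nonzero map to any shift of `Z` form a localizing subcategory. It contains `S`,
hence `Z`, so the identity of `Z` vanishes. -/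
lemma Generates.isZero (hgen : Generates S) {Z : T}
    (hZ : ∀ (n : ℤ) (x : S⟦n⟧ ⟶ Z), x = 0) : IsZero Z := by
  let P : ObjectProperty T := ((ObjectProperty.singleton Z).shiftClosure ℤ).leftOrthogonal
  have hP : P Z := by
    refine hgen Z P inferInstance ⟨?_⟩ (fun J => ⟨?_⟩) ?_
    · intro X Y r hY W f hW
      rw [← id_comp f, ← r.retract, assoc, hY (r.r ≫ f) hW, comp_zero]
    · rintro X ⟨h⟩ W f hW
      refine h.isColimit.hom_ext fun j => ?_
      rw [comp_zero]
      exact h.prop_diag_obj j _ hW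
    · rintro W f ⟨_, a, e, ⟨⟩⟩
      obtain ⟨y, hy⟩ := exists_unshift ((shiftFunctorZero T ℤ).hom.app S ≫ f ≫ e.hom)
      rw [hZ _ y, Functor.map_zero, comp_zero, Preadditive.IsIso.comp_left_eq_zero] at hy
      exact (Preadditive.IsIso.comp_right_eq_zero _ _).1 hy
  rw [IsZero.iff_id_eq_zero]
  exact hP (𝟙 Z) (ObjectProperty.le_shiftClosure _ _ ⟨()⟩)

lemma Generates.isIso (hgen : Generates S) {X Y : T} (f : X ⟶ Y)
    (hinj : ∀ (n : ℤ) (x : S⟦n⟧ ⟶ X), x ≫ f = 0 → x = 0)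
    (hsurj : ∀ (n : ℤ) (y : S⟦n⟧ ⟶ Y), ∃ x, x ≫ f = y) : IsIso f := by
  obtain ⟨Z, g, h, H⟩ := distinguished_cocone_triangle f
  suffices IsZero Z from (Triangle.isZero₃_iff_isIso₁ _ H).1 this
  refine hgen.isZero fun n z => ?_
  obtain ⟨y, hy⟩ := exists_unshift (z ≫ h)
  have hyf : y ≫ f = 0 := by
    rw [← unshift_comp_eq_zero_iff, ← hy, assoc, distTriang_comp₃₁ H, comp_zero]
  rw [hinj _ y hyf, Functor.map_zero, comp_zero] at hy
  obtain ⟨w, rfl⟩ := distTriang_fac₂ H z hy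
  obtain ⟨x, rfl⟩ := hsurj n w
  rw [assoc, distTriang_comp₁₂ H, comp_zero]

end Generation

/-! ### Local objects and lifting for an arbitrary localization at a prime -/

namespace LocalizationFunctor

variable {T : Type u} [Category.{v} T] [Preadditive T] [HasZeroObject T] [HasShift T ℤ]
  [∀ n : ℤ, (shiftFunctor T n).Additive] [Pretriangulated T] (L : LocalizationFunctor T)

lemma bijective_comp {X Y : T} (hX : L.localObjects X) :
    Function.Bijective (fun g : L.functor.obj Y ⟶ X => L.ι.app Y ≫ g) := by
  have := (L.mem_localObjects_iff X).1 hX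
  constructor
  · intro g g' h
    rw [← cancel_mono (L.ι.app X)]
    apply L.comp_injective
    simp only [← assoc]
    exact congrArg (· ≫ L.ι.app X) h
  · intro f
    refine ⟨L.functor.map f ≫ inv (L.ι.app X), ?_⟩
    have := L.ι.naturality f
    dsimp at this ⊢
    rw [← reassoc_of% this, IsIso.hom_inv_id, comp_id]

lemma exists_shift_comp_eq {X Y : T} (hX : L.localObjects X) {n : ℤ} (x : Y⟦n⟧ ⟶ X) :
    ∃ y : (L.functor.obj Y)⟦n⟧ ⟶ X, (L.ι.app Y)⟦n⟧' ≫ y = x := by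
  have := (L.mem_localObjects_iff X).1 hX
  obtain ⟨g, hg⟩ := (L.bijective_precomp X Y n).2 (x ≫ L.ι.app X)
  dsimp at hg
  exact ⟨g ≫ inv (L.ι.app X), by rw [reassoc_of% hg, IsIso.hom_inv_id, comp_id]⟩

variable {S : T} {p : PrimeIdeal S} {L} (hL : L.IsLocalizationAtPrime p)

include hL

lemma cellLocal_of_localObjects {X : T} (hX : L.localObjects X) :
    cellLocal (primeCone p) X := by
  obtain ⟨Y, ⟨e⟩⟩ := hX
  refine (cellLocal (primeCone p)).prop_of_iso e ?_
  rw [cellLocal_primeCone_iff]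
  intro n s hs m
  exact (bijective_act_iff s rfl).1 ((hL Y).bijective m n s hs)

/-- If the elements outside the prime already act invertibly on `π_* X`, inverting them changes
nothing, so `ι` is an isomorphism on homotopy. -/
lemma localObjects_of_cellLocal (hgen : Generates S) {X : T} (hX : cellLocal (primeCone p) X) :
    L.localObjects X := by
  rw [L.mem_localObjects_iff]
  rw [cellLocal_primeCone_iff] at hX
  refine hgen.isIso _ (fun m x hx => ?_) (fun m y => ?_)
  · obtain ⟨n, s, hs, h⟩ := (hL X).exists_of_eq_zero m x hx
    rw [act_eq_zero_iff] at h
    exact (hX n s hs m).1 (by simpa using h)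
  · obtain ⟨n, s, x, hs, h⟩ := (hL X).surj m y
    obtain ⟨x', rfl⟩ := ((bijective_act_iff s rfl).2 (hX n s hs m)).2 x
    refine ⟨x', ((hL X).bijective m n s hs).1 ?_⟩
    dsimp only at h ⊢
    rw [← h, act_comp]

lemma isIso_map_of_trW {c c' : T} {u : c' ⟶ c} (hu : (cellAcyclic (primeCone p)).trW u) :
    IsIso (L.functor.map u) := by
  have hloc : ∀ X, L.localObjects (L.functor.obj X) := fun X => L.functor.obj_mem_essImage X
  have hbij : ∀ X, L.localObjects X → Function.Bijective (fun g : c ⟶ X => u ≫ g) :=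
    fun X hX => bijective_comp_of_trW _ hu (cellLocal_of_localObjects hL hX)
  have hnat := L.ι.naturality u
  obtain ⟨r, hr⟩ := (hbij _ (hloc c')).2 (L.ι.app c')
  obtain ⟨q, rfl⟩ := (L.bijective_comp (hloc c')).2 r
  dsimp at hnat hr
  refine ⟨q, (L.bijective_comp (hloc c')).1 ?_, (L.bijective_comp (hloc c)).1 ?_⟩
  · dsimp only
    rw [← reassoc_of% hnat, hr, comp_id]
  · refine (hbij _ (hloc c)).1 ?_
    dsimp only
    rw [reassoc_of% hr, ← hnat, comp_id]

variable [IsTriangulated T] [HasCoproducts.{v} T]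

/-- Compactness applies to a telescope, not directly to `L Y`. The telescope `H` on `Y` is local,
which yields comparison maps; it is enough that they make `L Y` a retract of `H`. The map then
reaches a finite stage and descends the tower. -/
lemma exists_lift (hcompact : IsCompactObject S) (hgen : Generates S)
    {c Y : T} (hc : thickSubcategory S c) (g : c ⟶ L.functor.obj Y) :
    ∃ (c' : T) (u : c' ⟶ c) (v : c' ⟶ Y), thickSubcategory S c' ∧
      (cellAcyclic (primeCone p)).trW u ∧ v ≫ L.ι.app Y = u ≫ g := by
  obtain ⟨F, rfl, hF⟩ := exists_isCellTower (primeCone p) Y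
  obtain ⟨H, j, hj⟩ := exists_isTelescope F
  have hH := localObjects_of_cellLocal hL hgen
    (hF.cellLocal hj (primeCone_compact hcompact p))
  have hLY : L.localObjects (L.functor.obj (F.obj 0)) := L.functor.obj_mem_essImage _
  obtain ⟨k, hk⟩ := (L.bijective_comp hH).2 (j 0)
  obtain ⟨θ, hθ⟩ := (hF.bijective_comp hj (cellLocal_of_localObjects hL hLY)).2 (L.ι.app _)
  dsimp only at hk hθ
  have hkθ : k ≫ θ = 𝟙 _ := (L.bijective_comp hLY).1 (by
    dsimp only
    rw [reassoc_of% hk, hθ]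
    exact (comp_id _).symm)
  have hthick := thickSubcategory_le_compactObjects hcompact
  obtain ⟨n, f, hf⟩ := hj.exists_fac (hthick _ hc) (g ≫ k)
  obtain ⟨c', u, v, hc', hu, hv⟩ :=
    hF.exists_lift (thickSubcategory S) hthick (thickSubcategory_primeCone p) n hc f
  refine ⟨c', u, v, hc', hu, ?_⟩
  rw [← hθ, ← hj.map_comp (Nat.zero_le n), assoc, reassoc_of% hv, reassoc_of% hf, hkθ, comp_id]

end LocalizationFunctor

end GeneratingHypothesis

namespace GeneratingHypothesis

/-! ### The thick subcategory generated by the local unit -/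

namespace LocalizationFunctor

variable {T : Type u} [Category.{v} T] [Preadditive T] [HasZeroObject T] [HasShift T ℤ]
  [∀ n : ℤ, (shiftFunctor T n).Additive] [Pretriangulated T] (L : LocalizationFunctor T)

/-- The retracts of the localizations of the objects of the thick subcategory generated
by `S`. -/
def retractsOfThick (S : T) : ObjectProperty T := fun X =>
  ∃ c : T, thickSubcategory S c ∧ Nonempty (Retract X (L.functor.obj c))

variable (S : T)

instance : (L.retractsOfThick S).IsStableUnderRetracts where
  of_retract := by
    rintro X Y r ⟨c, hc, ⟨s⟩⟩
    exact ⟨c, hc, ⟨r.trans s⟩⟩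

instance : (L.retractsOfThick S).IsStableUnderShift ℤ where
  isStableUnderShiftBy n :=
    { le_shift := by
        rintro X ⟨c, hc, ⟨r⟩⟩
        exact ⟨c⟦n⟧, (thickSubcategory S).le_shift n _ hc,
          ⟨(r.map (shiftFunctor T n)).trans
            (.ofIso ((L.functor.commShiftIso n).symm.app c))⟩⟩ }

variable [IsTriangulated T] [HasCoproducts.{v} T]
  {L} {S} {p : PrimeIdeal S} (hL : L.IsLocalizationAtPrime p)

include hL

lemma retractsOfThick_isTriangulatedClosed₃ (hcompact : IsCompactObject S) (hgen : Generates S) :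
    (L.retractsOfThick S).IsTriangulatedClosed₃ := .mk' (by
  rintro D hD ⟨c₁, hc₁, ⟨r₁⟩⟩ ⟨c₂, hc₂, ⟨r₂⟩⟩
  obtain ⟨c', u, v, hc', hu, hv⟩ := exists_lift hL hcompact hgen hc₁
    (L.ι.app c₁ ≫ r₁.r ≫ D.mor₁ ≫ r₂.i)
  have hiso : IsIso (L.functor.map u) := isIso_map_of_trW hL hu
  -- Up to the isomorphism `L u`, the first map of `D`, extended to the ambient objects, is `L v`;
  -- so `L` of the cone of `v` is the candidate for the third vertex.
  have hmap : L.functor.map v = L.functor.map u ≫ r₁.r ≫ D.mor₁ ≫ r₂.i := by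
    apply L.comp_injective
    have h₁ := L.ι.naturality v
    have h₂ := L.ι.naturality u
    dsimp at h₁ h₂
    rw [← h₁, hv, ← reassoc_of% h₂]
  obtain ⟨Z, g, h, H⟩ := distinguished_cocone_triangle v
  have hD' : Triangle.mk (L.functor.map v) (L.functor.map g)
      (L.functor.map h ≫ (L.functor.commShiftIso (1 : ℤ)).hom.app c') ∈ distTriang T :=
    L.functor.map_distinguished _ H
  let i₁ : D.obj₁ ⟶ L.functor.obj c' := r₁.i ≫ inv (L.functor.map u)
  let q₁ : L.functor.obj c' ⟶ D.obj₁ := L.functor.map u ≫ r₁.r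
  have hi : D.mor₁ ≫ r₂.i = i₁ ≫ L.functor.map v := by
    rw [hmap, assoc, IsIso.inv_hom_id_assoc, r₁.retract_assoc]
  have hq : L.functor.map v ≫ r₂.r = q₁ ≫ D.mor₁ := by
    rw [hmap]
    simp only [q₁, assoc, r₂.retract, comp_id]
  let φ := completeDistinguishedTriangleMorphism D _ hD hD' i₁ r₂.i hi
  let ψ := completeDistinguishedTriangleMorphism _ D hD' hD q₁ r₂.r hq
  have h₁ : (φ ≫ ψ).hom₁ = 𝟙 _ := by
    change i₁ ≫ q₁ = 𝟙 _
    rw [assoc, IsIso.inv_hom_id_assoc, r₁.retract]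
  have h₂ : (φ ≫ ψ).hom₂ = 𝟙 _ := r₂.retract
  let a : D.obj₃ ⟶ L.functor.obj Z := φ.hom₃
  let b : L.functor.obj Z ⟶ D.obj₃ := ψ.hom₃
  -- Fill-ins on cones are not functorial, so `a ≫ b` is an isomorphism but perhaps not the
  -- identity; the retraction is corrected by its inverse.
  have h₃ : IsIso (a ≫ b) := isIso₃_of_isIso₁₂ (φ ≫ ψ) hD hD
    (by rw [h₁]; infer_instance) (by rw [h₂]; infer_instance)
  exact ⟨Z, (thickSubcategory S).ext_of_isTriangulatedClosed₃ _ H hc' hc₂,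
    ⟨⟨a, b ≫ inv (a ≫ b), by rw [← assoc, IsIso.hom_inv_id]⟩⟩⟩)

lemma thickSubcategory_localUnit_le (hcompact : IsCompactObject S) (hgen : Generates S) :
    thickSubcategory (L.localUnit S) ≤ (L.retractsOfThick S).inverseImage L.localObjects.ι := by
  have := retractsOfThick_isTriangulatedClosed₃ hL hcompact hgen
  have hS : thickSubcategory S S := ObjectProperty.le_triangEnvelope _ _ ⟨()⟩
  have : (L.retractsOfThick S).IsTriangulated :=
    { exists_zero := ⟨0, isZero_zero T, S, hS, ⟨0, 0, (isZero_zero T).eq_of_src _ _⟩⟩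
      toIsTriangulatedClosed₂ := .of_isTriangulatedClosed₃ }
  have : ((L.retractsOfThick S).inverseImage L.localObjects.ι).IsStableUnderRetracts :=
    ⟨fun r h => (L.retractsOfThick S).prop_of_retract (r.map L.localObjects.ι) h⟩
  rw [ObjectProperty.triangEnvelope_le_iff, ObjectProperty.singleton_le_iff]
  exact ⟨S, hS, ⟨.refl _⟩⟩

end LocalizationFunctor

/-! ### Transfer of the generating hypotheses -/

section HomotopyFunctor

variable {C : Type u} [Category.{v} C] [HasShift C ℤ] [Preadditive C]

lemma homotopyFunctor_map_eq_iff (S : C) {X Y : C} (f g : X ⟶ Y) :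
    (homotopyFunctor S).map f = (homotopyFunctor S).map g ↔
      ∀ (n : ℤ) (x : S⟦n⟧ ⟶ X), x ≫ f = x ≫ g := by
  constructor
  · intro h n x
    exact ConcreteCategory.congr_hom (congrFun h n) x
  · intro h
    funext n
    ext x
    exact h n x

lemma homotopyFunctor_map_eq_zero_iff (S : C) {X Y : C} (f : X ⟶ Y) :
    (homotopyFunctor S).map f = 0 ↔ ∀ (n : ℤ) (x : S⟦n⟧ ⟶ X), x ≫ f = 0 := by
  constructor
  · intro h n x
    exact ConcreteCategory.congr_hom (congrFun h n) x
  · intro h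
    funext n
    ext x
    exact h n x

end HomotopyFunctor

namespace LocalizationFunctor

variable {T : Type u} [Category.{v} T] [Preadditive T] [HasZeroObject T] [HasShift T ℤ]
  [∀ n : ℤ, (shiftFunctor T n).Additive] [Pretriangulated T] (L : LocalizationFunctor T)

lemma exists_localUnit_fac (S : T) {X : L.LocalCategory} {n : ℤ} (x : S⟦n⟧ ⟶ X.obj) :
    ∃ (a : S⟦n⟧ ⟶ ((L.localUnit S)⟦n⟧).obj) (y : (L.localUnit S)⟦n⟧ ⟶ X), x = a ≫ y.hom := by
  obtain ⟨y, rfl⟩ := L.exists_shift_comp_eq X.property x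
  let e := (L.localObjects.ι.commShiftIso n).app (L.localUnit S)
  exact ⟨(L.ι.app S)⟦n⟧' ≫ e.inv, ObjectProperty.homMk (e.hom ≫ y), by
    rw [ObjectProperty.homMk_hom, assoc, e.inv_hom_id_assoc]⟩

lemma comp_hom_eq_of_forall_comp_eq {S : T} {X Y : L.LocalCategory} {f g : X ⟶ Y}
    (h : ∀ (n : ℤ) (x : (L.localUnit S)⟦n⟧ ⟶ X), x ≫ f = x ≫ g) (n : ℤ) (x : S⟦n⟧ ⟶ X.obj) :
    x ≫ f.hom = x ≫ g.hom := by
  obtain ⟨a, y, rfl⟩ := L.exists_localUnit_fac S x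
  rw [assoc, assoc]
  exact congrArg (fun z => a ≫ z.hom) (h n y)

lemma globalGeneratingHypothesis_localUnit {S : T} (h : GlobalGeneratingHypothesis S) :
    GlobalGeneratingHypothesis (L.localUnit S) where
  map_injective {X Y f g} hfg := by
    rw [homotopyFunctor_map_eq_iff] at hfg
    ext
    refine h.map_injective ?_
    rw [homotopyFunctor_map_eq_iff]
    exact L.comp_hom_eq_of_forall_comp_eq hfg

lemma strongGeneratingHypothesis_localUnit [IsTriangulated T] [HasCoproducts.{v} T] {S : T}
    (hcompact : IsCompactObject S) (hgen : Generates S) {p : PrimeIdeal S}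
    (hL : L.IsLocalizationAtPrime p) (h : StrongGeneratingHypothesis S) :
    StrongGeneratingHypothesis (L.localUnit S) := by
  intro X Y f hX hf
  obtain ⟨c, hc, ⟨r⟩⟩ := thickSubcategory_localUnit_le hL hcompact hgen X hX
  rw [homotopyFunctor_map_eq_zero_iff] at hf
  have hf' := L.comp_hom_eq_of_forall_comp_eq (f := f) (g := 0)
    (fun n x => (hf n x).trans comp_zero.symm)
  -- The object `X` itself need not lie in the thick subcategory of `S`, but `c` does, so the strong
  -- hypothesis in `T` is applied to this composite.
  have hzero : L.ι.app c ≫ r.r ≫ f.hom = 0 := by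
    refine h _ _ _ hc ((homotopyFunctor_map_eq_zero_iff S _).2 fun n x => ?_)
    have := hf' n (x ≫ L.ι.app c ≫ r.r)
    simpa using this
  have hzero' : r.r ≫ f.hom = 0 :=
    (L.bijective_comp Y.property).1 (hzero.trans comp_zero.symm)
  ext
  have := r.i ≫= hzero'
  rw [r.retract_assoc, comp_zero] at this
  exact this

end LocalizationFunctor

end GeneratingHypothesis

open GeneratingHypothesis in
theorem proposition3p6 {T : Type u} [Category.{v} T] [Preadditive T] [HasZeroObject T]
    [HasShift T ℤ] [∀ n : ℤ, (shiftFunctor T n).Additive] [Pretriangulated T] [IsTriangulated T]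
    [HasCoproducts.{v} T] (S : T) (hcompact : IsCompactObject S) (hgen : Generates S)
    (hcomm : IsGradedCommutative S) (p : PrimeIdeal S) :
    (∃ L : LocalizationFunctor T, L.IsLocalizationAtPrime p) ∧
      ∀ L : LocalizationFunctor T, L.IsLocalizationAtPrime p →
        (StrongGeneratingHypothesis S → StrongGeneratingHypothesis (L.localUnit S)) ∧
          (GlobalGeneratingHypothesis S → GlobalGeneratingHypothesis (L.localUnit S)) := by

  exact ⟨exists_localizationFunctor_isLocalizationAtPrime hcompact hcomm p, fun L hL =>
    ⟨L.strongGeneratingHypothesis_localUnit hcompact hgen hL,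
      L.globalGeneratingHypothesis_localUnit⟩⟩
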